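/- Let $G$ be a Hausdorff topological group. A compactification $(bG,b)$ of $G$ is a compact Hausdorff space $bG$ with a dense topological embedding $b:G\to bG$. Write $bG\le b'G$ if there is a continuous map $\varphi:b'G\to bG$ with $\varphi\circ b'=b$; compactifications that are $\le$ each other are identified, so that compactifications of $G$ form a poset. Let $\alpha(g,h)=gh$ and $\alpha^*(g,h)=hg^{-1}$ be the left action of $G$ on itself and its inverse action. Let - $\mathbb G(G)$ be the poset of $G$-compactifications: $\alpha$ extends to a continuous action $\tilde\alpha:G\times bG\to bG$, written $gx=\tilde\alpha(g,x)$; - $\mathbb G^{\leftrightarrow}(G)\subset\mathbb G(G)$ be the subposet of those for which also $\alpha^*$ extends to a continuous action of $G$ on $bG$; - $\mathbb G^{*}(G)\subset\mathbb G(G)$ be the subposet of those for which the inversion $g\mapsto g^{-1}$ extends to a continuous self-inverse map $bG\to bG$. For a compact Hausdorff space $X$ let $2^{X}$ be the set of its closed subsets with the Vietoris topology. For a $G$-compactification $bG$ let $\mathfrak G(bG)$ be the closure in $2^{bG\times bG}$ of the set of graphs $\Gamma(g)=\{(x,gx)\mid x\in bG\}$, $g\in G$, regarded as a compactification of $G$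 by means of $g\mapsto\Gamma(g)$. Let $b_rG$ be the Roelcke compactification of $G$: the completion of $G$ with respect to the finest totally bounded uniformity coarser than the Roelcke uniformity $L\wedge R$, the greatest lower bound of the left and the right uniformities of $G$. Theorem. $\mathfrak G$ is a well-defined map $\mathbb G(G)\to\mathbb G^*(G)$, and: 1. $\mathfrak G$ is a morphism of posets (it is order preserving); 2. $bG\le\mathfrak G(bG)$ for every $bG\in\mathbb G^{\leftrightarrow}(G)$; 3. $\mathfrak G(bG)\le b_rG$ for every $bG\in\mathbb G(G)$, and if $b_rG\le bG$, then $\mathfrak G(bG)=b_rG$; 4. let $bG\in\mathbb G^{\leftrightarrow}(G)$ and let $\mathcal U$ be the subspace uniformity on $G$ induced by the unique compatible uniformity of $bG$, given by its uniform covers; for a cover $u$ let $\mathrm{st}(x,u)=\bigcup\{U\in u\mid x\in U\}$. Then $\mathfrak G(bG)=bG$ if and only if for every $u\in\mathcal U$ there is $v\in\mathcal U$ such that for all $g,h\in G$ with $g\in\mathrm{st}(h,v)$ $$\forall y\in G\ \exists x\in G:\ y\in\mathrm{st}(x,u),\ hy\in\mathrm{st}(gx,u)\quad\text{and}\quad\forall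 x\in G\ \exists y\in G:\ x\in\mathrm{st}(y,u),\ gx\in\mathrm{st}(hy,u).$$ -/

import Mathlib

open Topology Filter Set
open scoped Uniformity

universe u

noncomputable section

/-! ### Compactifications and their order -/

/-- A (proper) compactification of a topological space `X`: a compact Hausdorff space together with
a dense topological embedding of `X`. -/
structure Compactification (X : Type u) [TopologicalSpace X] : Type (u + 1) where
  carrier : Type u
  [topology : TopologicalSpace carrier]
  [compact : CompactSpace carrier]
  [hausdorff : T2Space carrier]
  map : X → carrier
  isEmbedding : IsEmbedding map
  denseRange : DenseRange map

namespace Compactification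

variable {X : Type u} [TopologicalSpace X]

attribute [instance] topology compact hausdorff

/-- `B ≤ C` iff there is a map of compactifications from `C` to `B`, that is, a continuous map
which is the identity on `X`. -/
instance : Preorder (Compactification X) where
  le B C := ∃ φ : C.carrier → B.carrier, Continuous φ ∧ ∀ x, φ (C.map x) = B.map x
  le_refl _ := ⟨id, continuous_id, fun _ => rfl⟩
  le_trans _ _ _ := fun ⟨φ, hφ, h⟩ ⟨ψ, hψ, k⟩ =>
    ⟨φ ∘ ψ, hφ.comp hψ, fun x => by simp [k, h]⟩

end Compactification

/-- The poset of compactifications of `X`, where compactifications which are `≤` each other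
(equivalently, are homeomorphic by a homeomorphism fixing `X`) are identified. -/
abbrev CompactificationPoset (X : Type u) [TopologicalSpace X] : Type (u + 1) :=
  Antisymmetrization (Compactification X) (· ≤ ·)

/-- The element of the poset of compactifications that is represented by `B`. -/
def Compactification.cls {X : Type u} [TopologicalSpace X] (B : Compactification X) :
    CompactificationPoset X :=
  toAntisymmetrization (· ≤ ·) B

/-! ### Equivariant compactifications of a topological group -/

section Group

variable {G : Type u} [Group G] [TopologicalSpace G]

/-- A continuous action of `G` on the compactification `B` of `G`, extending the action
`(g, h) ↦ a g h` of `G` on itself. -/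
structure ActionExtension (B : Compactification G) (a : G → G → G) : Type u where
  act : G → B.carrier → B.carrier
  act_one : ∀ x, act 1 x = x
  act_mul : ∀ g h x, act (g * h) x = act g (act h x)
  continuous_act : Continuous (Function.uncurry act)
  act_map : ∀ g h, act g (B.map h) = B.map (a g h)

/-- The action of `G` on itself by left multiplication. -/
def leftMul (g h : G) : G := g * h

/-- The inverse action `(g, h) ↦ (g h⁻¹)⁻¹ = h g⁻¹` of `G` on itself. -/
def leftMulStar (g h : G) : G := h * g⁻¹

/-- `G`-compactifications: the left action of `G` on itself extends. -/
def Compactification.IsG (B : Compactification G) : Prop :=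
  Nonempty (ActionExtension B leftMul)

/-- `G^↔`-compactifications: both the left action and its inverse action extend. -/
def Compactification.IsGBi (B : Compactification G) : Prop :=
  Nonempty (ActionExtension B leftMul) ∧ Nonempty (ActionExtension B leftMulStar)

/-- `G^*`-compactifications: the left action extends, and so does the involution `g ↦ g⁻¹`, to a
continuous self-inverse map. -/
def Compactification.IsGStar (B : Compactification G) : Prop :=
  Nonempty (ActionExtension B leftMul) ∧
    ∃ s : B.carrier → B.carrier, Continuous s ∧ (∀ x, s (s x) = x) ∧ ∀ g, s (B.map g) = B.map g⁻¹

variable (G)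

/-- The poset `𝔾(G)` of `G`-compactifications. -/
def GPoset : Set (CompactificationPoset G) := {p | ∃ B : Compactification G, B.IsG ∧ B.cls = p}

/-- The poset `𝔾^↔(G)` of `G^↔`-compactifications. -/
def GBiPoset : Set (CompactificationPoset G) := {p | ∃ B : Compactification G, B.IsGBi ∧ B.cls = p}

/-- The poset `𝔾^*(G)` of `G^*`-compactifications. -/
def GStarPoset : Set (CompactificationPoset G) :=
  {p | ∃ B : Compactification G, B.IsGStar ∧ B.cls = p}

variable {G}

/-- The element of `𝔾(G)` represented by a `G`-compactification. -/
def ActionExtension.cls {B : Compactification G} (θ : ActionExtension B leftMul) : GPoset G :=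
  ⟨B.cls, B, ⟨θ⟩, rfl⟩

end Group

/-! ### The closure of the graphs in the hyperspace -/

section Graph

open TopologicalSpace (Compacts)

variable {G : Type u} [Group G] [TopologicalSpace G] {B : Compactification G}

/-- The graph `{(x, g x) | x ∈ bG}` of `g`, a point of the hyperspace `2^{bG × bG}` of closed
(that is, compact) subsets of `bG × bG`, which carries the Vietoris topology. -/
def ActionExtension.graph (θ : ActionExtension B leftMul) (g : G) :
    Compacts (B.carrier × B.carrier) where
  carrier := range fun x => (x, θ.act g x)
  isCompact' := isCompact_range <|
    continuous_id.prodMk (θ.continuous_act.comp (Continuous.prodMk_right g))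

theorem ActionExtension.continuous_graph (θ : ActionExtension B leftMul) :
    Continuous θ.graph := by
  have h : Continuous (Function.uncurry fun (g : G) (x : B.carrier) => (x, θ.act g x)) :=
    continuous_snd.prodMk θ.continuous_act
  have h2 := (continuous_const (y := (⊤ : Compacts B.carrier))).compacts_map' (β := B.carrier) h
  convert h2 using 2 with g
  ext p
  simp [ActionExtension.graph]

theorem ActionExtension.isEmbedding_graph (θ : ActionExtension B leftMul) :
    IsEmbedding θ.graph := by
  have key : ∀ g f : G, B.map f ∈ ({q | (B.map 1, q) ∈ (θ.graph g : Set _)} : Set B.carrier) →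
      f = g := by
    rintro g f ⟨x, hx⟩
    simp only [Prod.mk.injEq] at hx
    obtain ⟨rfl, hx⟩ := hx
    rw [θ.act_map] at hx
    simpa [leftMul] using (B.isEmbedding.injective hx).symm
  have self : ∀ g : G, (B.map 1, B.map g) ∈ (θ.graph g : Set _) := fun g =>
    ⟨B.map 1, by simp [θ.act_map, leftMul]⟩
  refine ⟨isInducing_iff_nhds.2 fun g => le_antisymm θ.continuous_graph.continuousAt.le_comap ?_,
    fun g f h => (key f g (h ▸ self g))⟩
  intro W hW
  rw [B.isEmbedding.isInducing.nhds_eq_comap] at hW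
  obtain ⟨W', hW', hsub⟩ := hW
  obtain ⟨O, hOW, hO, hgO⟩ := mem_nhds_iff.1 hW'
  have hcl : IsClosed (({B.map 1} : Set B.carrier) ×ˢ Oᶜ) := isClosed_singleton.prod hO.isClosed_compl
  refine ⟨{F | (F : Set (B.carrier × B.carrier)) ⊆ (({B.map 1} : Set B.carrier) ×ˢ Oᶜ)ᶜ},
    (Compacts.isOpen_subsets_of_isOpen hcl.isOpen_compl).mem_nhds ?_, fun f hf => hsub (hOW ?_)⟩
  · rintro _ ⟨x, rfl⟩ ⟨hx, hx'⟩
    have hx : x = B.map 1 := hx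
    subst hx
    refine hx' ?_
    simpa [θ.act_map, leftMul] using hgO
  · by_contra hcon
    exact hf (self f) ⟨rfl, hcon⟩

/-- The closure in `2^{bG × bG}` of the set of graphs of elements of `G`, as a compactification of
`G` by the map sending `g` to its graph. -/
def graphCompactification (θ : ActionExtension B leftMul) : Compactification G where
  carrier := closure (range θ.graph)
  compact := isCompact_iff_compactSpace.1 isClosed_closure.isCompact
  map g := ⟨θ.graph g, subset_closure (mem_range_self g)⟩
  isEmbedding := θ.isEmbedding_graph.codRestrict _ _
  denseRange := by
    rw [DenseRange, Subtype.dense_iff]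
    intro x hx
    rwa [← range_comp]

end Graph

/-! ### The Roelcke compactification -/

/-- The precompact replica of the uniformity `𝒰`: the finest totally bounded uniformity which is
coarser than `𝒰` (Mathlib orders uniformities so that finer ones are smaller). -/
def precompactReplica {X : Type u} (𝒰 : UniformSpace X) : UniformSpace X :=
  sInf {𝒱 | 𝒰 ≤ 𝒱 ∧ @TotallyBounded X 𝒱 univ}

/-- The Roelcke uniformity `L ∧ R` on `G`: the finest uniformity which is coarser than both the
left and the right uniformity. -/
def roelckeUniformity (G : Type u) [Group G] [TopologicalSpace G] [IsTopologicalGroup G] :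
    UniformSpace G :=
  IsTopologicalGroup.leftUniformSpace G ⊔ IsTopologicalGroup.rightUniformSpace G

theorem exists_countable_uniformity {X : Type u} [𝒰 : UniformSpace X] {D : Set (X × X)}
    (hD : D ∈ 𝓤 X) : ∃ 𝒱 : UniformSpace X, 𝒰 ≤ 𝒱 ∧ D ∈ 𝓤[𝒱] ∧ IsCountablyGenerated 𝓤[𝒱] := by
  have step : ∀ V : {V : SetRel X X // V ∈ 𝓤 X}, ∃ W : {V : SetRel X X // V ∈ 𝓤 X},
      W.1.IsSymm ∧ SetRel.comp W.1 W.1 ⊆ V.1 := fun V => by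
    obtain ⟨W, hW, hs, hc⟩ := comp_symm_mem_uniformity_sets V.2
    exact ⟨⟨W, hW⟩, hs, hc⟩
  choose f hf1 hf2 using step
  let V : ℕ → {V : SetRel X X // V ∈ 𝓤 X} := fun n => f^[n] ⟨D, hD⟩
  have hV : ∀ n, V (n + 1) = f (V n) := fun n => Function.iterate_succ_apply' f n _
  have hsub : ∀ n, (V (n + 1)).1 ⊆ (V n).1 := fun n p hp => by
    rw [hV] at hp
    exact hf2 _ ⟨p.2, hp, refl_mem_uniformity (f (V n)).2⟩
  have hanti : Antitone fun n => (V n).1 := antitone_nat_of_succ_le hsub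
  have hb : (⨅ n, 𝓟 (V n).1).HasAntitoneBasis fun n => (V n).1 :=
    HasAntitoneBasis.iInf_principal hanti
  let c : UniformSpace.Core X :=
    { uniformity := ⨅ n, 𝓟 (V n).1
      refl := le_iInf fun n => principal_mono.2 fun p hp => by
        obtain ⟨x, y⟩ := p
        obtain rfl : x = y := hp
        exact refl_mem_uniformity (V n).2
      symm := hb.1.tendsto_right_iff.2 fun n _ => by
        filter_upwards [hb.1.mem_of_mem (i := n + 1) trivial] with p hp
        apply hsub
        rw [hV] at hp ⊢
        have := hf1 (V n)
        exact this.symm _ _ hp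
      comp := by
        refine hb.1.ge_iff.2 fun n _ => ?_
        refine mem_of_superset (mem_lift' (hb.1.mem_of_mem (i := n + 1) trivial)) ?_
        rw [hV]
        exact hf2 _ }
  refine ⟨UniformSpace.ofCore c, ?_, ?_, ?_⟩
  · change 𝓤 X ≤ ⨅ n, 𝓟 (V n).1
    exact le_iInf fun n => le_principal_iff.2 (V n).2
  · exact hb.1.mem_of_mem (i := 0) trivial
  · change IsCountablyGenerated (⨅ n, 𝓟 (V n).1)
    exact hb.isCountablyGenerated

theorem totallyBounded_comap_compact {X K : Type*} [UniformSpace K] [CompactSpace K] (f : X → K) :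
    @TotallyBounded X (UniformSpace.comap f ‹_›) univ := by
  let _ := UniformSpace.comap f ‹UniformSpace K›
  simpa using totallyBounded_preimage (f := f) ⟨rfl⟩ (isCompact_univ (X := K)).totallyBounded

theorem toTopologicalSpace_precompactReplica {X : Type u} (𝒰 : UniformSpace X) :
    (precompactReplica 𝒰).toTopologicalSpace = 𝒰.toTopologicalSpace := by
  refine le_antisymm ?_ (UniformSpace.toTopologicalSpace_mono (le_sInf fun _ h => h.1))
  refine le_of_nhds_le_nhds fun x W hW => ?_
  rw [@UniformSpace.mem_nhds_iff] at hW
  obtain ⟨D, hD, hDW⟩ := hW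
  obtain ⟨𝒱, h𝒱, hD𝒱, hc⟩ := exists_countable_uniformity hD
  let pm : PseudoMetricSpace X := @UniformSpace.pseudoMetricSpace X 𝒱 hc
  have hpm : pm.toUniformSpace = 𝒱 := rfl
  obtain ⟨ε, hε, hεD⟩ := Metric.mem_uniformity_dist.1 hD𝒱
  let f : X → Icc (0 : ℝ) ε := fun y => projIcc 0 ε hε.le (dist y x)
  have hf : @UniformContinuous X _ 𝒱 _ f :=
    (LipschitzWith.projIcc hε.le).uniformContinuous.comp
      (UniformContinuous.dist uniformContinuous_id uniformContinuous_const)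
  have hle : precompactReplica 𝒰 ≤ UniformSpace.comap f inferInstance :=
    sInf_le ⟨h𝒱.trans (@uniformContinuous_iff_le_comap _ _ 𝒱 _ f |>.1 hf),
      totallyBounded_comap_compact f⟩
  refine UniformSpace.to_nhds_mono hle x ?_
  change W ∈ @nhds X (TopologicalSpace.induced f _) x
  rw [nhds_induced]
  refine ⟨{t | (t : ℝ) < ε}, (isOpen_lt continuous_subtype_val continuous_const).mem_nhds ?_, ?_⟩
  · simpa [f, projIcc] using hε
  · intro y hy
    have hy : dist y x < ε := by
      by_contra! hcon
      have : f y = ⟨ε, right_mem_Icc.2 hε.le⟩ := projIcc_of_right_le _ hcon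
      rw [mem_preimage, this] at hy
      exact lt_irrefl ε hy
    exact hDW (hεD (by rwa [dist_comm] at hy))

section Roelcke

variable (G : Type u) [Group G] [TopologicalSpace G] [IsTopologicalGroup G]

theorem toTopologicalSpace_roelckeUniformity :
    (roelckeUniformity G).toTopologicalSpace = ‹TopologicalSpace G› := by
  refine le_antisymm ?_ (UniformSpace.toTopologicalSpace_mono
    (le_sup_left : IsTopologicalGroup.leftUniformSpace G ≤ roelckeUniformity G))
  let S : Set G → SetRel G G := fun O => {p | ∃ a ∈ O, ∃ b ∈ O, p.2 = a * p.1 * b}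
  have hSm : Monotone S := fun O O' h p ⟨a, ha, b, hb, e⟩ => ⟨a, h ha, b, h hb, e⟩
  have hb : ((𝓝 (1 : G)).lift' S).HasBasis (fun O => O ∈ 𝓝 (1 : G)) S :=
    (𝓝 (1 : G)).basis_sets.lift' hSm
  let c : UniformSpace.Core G :=
    { uniformity := (𝓝 (1 : G)).lift' S
      refl := by
        refine hb.ge_iff.2 fun O hO => ?_
        rintro ⟨x, y⟩ hp
        obtain rfl : x = y := hp
        exact ⟨1, mem_of_mem_nhds hO, 1, mem_of_mem_nhds hO, by simp⟩
      symm := hb.tendsto_right_iff.2 fun O hO => by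
        have hO' : O⁻¹ ∈ 𝓝 (1 : G) := inv_mem_nhds_one G hO
        filter_upwards [hb.mem_of_mem hO'] with p ⟨a, ha, b, hb, e⟩
        exact ⟨a⁻¹, ha, b⁻¹, hb, by simp [e, mul_assoc]⟩
      comp := by
        refine hb.ge_iff.2 fun O hO => ?_
        obtain ⟨V, hV, hVO⟩ := exists_nhds_one_split hO
        refine mem_of_superset (mem_lift' (hb.mem_of_mem hV)) ?_
        rintro ⟨x, z⟩ ⟨y, ⟨a, ha, b, hb, e⟩, ⟨a', ha', b', hb', e'⟩⟩
        refine ⟨a' * a, hVO _ ha' _ ha, b * b', hVO _ hb _ hb', ?_⟩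
        simp only at e e' ⊢
        rw [e', e]
        group }
  have hle : roelckeUniformity G ≤ UniformSpace.ofCore c := by
    refine sup_le ?_ ?_
    · change comap (fun p : G × G => p.1⁻¹ * p.2) (𝓝 1) ≤ (𝓝 (1 : G)).lift' S
      refine hb.ge_iff.2 fun O hO => ⟨O, hO, fun p hp => ?_⟩
      exact ⟨1, mem_of_mem_nhds hO, p.1⁻¹ * p.2, hp, by simp⟩
    · change comap (fun p : G × G => p.2 * p.1⁻¹) (𝓝 1) ≤ (𝓝 (1 : G)).lift' S
      refine hb.ge_iff.2 fun O hO => ⟨O, hO, fun p hp => ?_⟩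
      exact ⟨p.2 * p.1⁻¹, hp, 1, mem_of_mem_nhds hO, by simp⟩
  refine (UniformSpace.toTopologicalSpace_mono hle).trans (le_of_nhds_le_nhds fun x W hW => ?_)
  rw [@UniformSpace.mem_nhds_iff]
  have ht : Tendsto (fun q : G × G => q.1 * x * q.2) (𝓝 1 ×ˢ 𝓝 1) (𝓝 x) := by
    have h : Continuous fun q : G × G => q.1 * x * q.2 := by fun_prop
    have h2 := h.tendsto (1, 1)
    rwa [nhds_prod_eq, one_mul, mul_one] at h2
  obtain ⟨O, hO, hOW⟩ := mem_prod_same_iff.1 (ht hW)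
  refine ⟨S O, hb.mem_of_mem hO, ?_⟩
  rintro y ⟨a, ha, b, hb, e⟩
  simp only at e
  rw [e]
  exact hOW (mk_mem_prod ha hb)

theorem totallyBounded_precompactReplica {X : Type u} (𝒰 : UniformSpace X) :
    @TotallyBounded X (precompactReplica 𝒰) univ := by
  rw [@totallyBounded_iff_ultrafilter]
  intro f _
  refine ⟨f.neBot, ?_⟩
  change _ ≤ ⨅ 𝒱 ∈ {𝒱 : UniformSpace X | 𝒰 ≤ 𝒱 ∧ @TotallyBounded X 𝒱 univ}, 𝓤[𝒱]
  exact le_iInf₂ fun 𝒱 h => (@Ultrafilter.cauchy_of_totallyBounded X 𝒱 _ f h.2 (by simp)).2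

/-- The Roelcke compactification `b_r G`: the completion of `G` with respect to the precompact
replica of the Roelcke uniformity. -/
def roelckeCompactification [T2Space G] : Compactification G :=
  letI := precompactReplica (roelckeUniformity G)
  { carrier := UniformSpace.Completion G
    compact := by
      refine ⟨TotallyBounded.isCompact_of_isClosed ?_ isClosed_univ⟩
      have h := ((totallyBounded_precompactReplica (roelckeUniformity G)).image
        (UniformSpace.Completion.uniformContinuous_coe G)).closure
      rwa [image_univ, UniformSpace.Completion.denseRange_coe.closure_range] at h
    map := fun g => (g : UniformSpace.Completion G)
    isEmbedding := by
      have ht := (toTopologicalSpace_precompactReplica (roelckeUniformity G)).trans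
        (toTopologicalSpace_roelckeUniformity G)
      have h0 : @T0Space G (precompactReplica (roelckeUniformity G)).toTopologicalSpace := by
        rw [ht]; infer_instance
      have h := (UniformSpace.Completion.isUniformEmbedding_coe G).isEmbedding
      rwa [ht] at h
    denseRange := UniformSpace.Completion.denseRange_coe }

end Roelcke

/-! ### The subspace uniformity, uniform covers and stars -/

/-- The subspace uniformity on `X` as a subset of the compact space `bX` with its unique
compatible uniformity. -/
def Compactification.subspaceUniformity {X : Type u} [TopologicalSpace X]
    (B : Compactification X) : UniformSpace X :=
  UniformSpace.comap B.map uniformSpaceOfCompactR1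

/-- `u` is a uniform cover with respect to `𝒰`: it is refined by the cover by the `D`-balls for
some entourage `D`. -/
def IsUniformCover {X : Type*} (𝒰 : UniformSpace X) (u : Set (Set X)) : Prop :=
  ∃ D ∈ 𝓤[𝒰], ∀ x, ∃ U ∈ u, {y | (x, y) ∈ D} ⊆ U

/-- The star of the point `x` with respect to the cover `u`. -/
def coverStar {X : Type*} (x : X) (u : Set (Set X)) : Set X := ⋃₀ {U ∈ u | x ∈ U}

/-- For every uniform cover `u` of the subspace uniformity on `G` there is a uniform cover `v` such
that `g ∈ st(h, v)` implies that the graphs of the left translations by `g` and by `h` on `G` are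
contained in each other's `u × u`-stars. -/
def Compactification.ConditionF {G : Type u} [Group G] [TopologicalSpace G]
    (B : Compactification G) : Prop :=
  ∀ u, IsUniformCover B.subspaceUniformity u → ∃ v, IsUniformCover B.subspaceUniformity v ∧
    ∀ g h : G, g ∈ coverStar h v →
      (∀ y : G, ∃ x : G, y ∈ coverStar x u ∧ h * y ∈ coverStar (g * x) u) ∧
      (∀ x : G, ∃ y : G, x ∈ coverStar y u ∧ g * x ∈ coverStar (h * y) u)

end

/-! A compactification of `G` is determined by the uniformity it induces on `G`, and `≤` is
inclusion of these uniformities (`le_iff_subspaceUniformity_le`). The proof therefore takes place on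
`G` itself. The central fact is `uniformity_graphCompactification`: by density of `G` in `bG`, the
uniformity of `𝔊(bG)` has as base the sets `graphEntourage D`, with `D` an entourage of `bG`.
Monotonicity is then immediate, inversion extends because it swaps the coordinates of a graph, and
left translation extends because it acts on the second coordinate. Graphs depend uniformly on `g`
for both the left and the right uniformity, so `𝔊(bG)` lies below `b_rG`; this also gives joint
continuity of the extended action. If `α*` extends, comparing graphs over the point `1` recovers
closeness in `bG`, whence `bG ≤ 𝔊(bG)`. As `b_rG` is itself such a compactification, `b_rG ≤ 𝔊(b_rG)
≤ 𝔊(bG)` once `b_rG ≤ bG`. The criterion in 4 is `𝔊(bG) ≤ bG` written with covers. -/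

namespace Compactification

/-! ### Compactifications as uniformities -/

section Uniformity

variable {X : Type u} [TopologicalSpace X]

/-- The unique compatible uniformity of a compactification. -/
instance uniformSpace (B : Compactification X) : UniformSpace B.carrier :=
  { uniformSpaceOfCompactR1 (γ := B.carrier) with toTopologicalSpace := B.topology }

theorem subspaceUniformity_eq (B : Compactification X) :
    B.subspaceUniformity = UniformSpace.comap B.map B.uniformSpace := rfl

/-- Uniqueness of the uniformity of a compact space allows computing with the Hausdorff uniformity
of a hyperspace or with that of a completion. -/
theorem subspaceUniformity_eq_comap (B : Compactification X) (𝒱 : UniformSpace B.carrier)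
    (h : 𝒱.toTopologicalSpace = B.topology) :
    B.subspaceUniformity = UniformSpace.comap B.map 𝒱 := by
  rw [subspaceUniformity_eq, unique_uniformity_of_compact (u := B.uniformSpace) (u' := 𝒱) rfl h]

theorem mem_subspaceUniformity {B : Compactification X} {D : Set (X × X)} :
    D ∈ 𝓤[B.subspaceUniformity] ↔
      ∃ E ∈ 𝓤 B.carrier, ∀ x y, (B.map x, B.map y) ∈ E → (x, y) ∈ D := by
  rw [subspaceUniformity_eq, uniformity_comap, mem_comap]
  simp only [subset_def, Prod.forall, mem_preimage, Prod.map]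

theorem preimage_mem_subspaceUniformity {B : Compactification X}
    {E : Set (B.carrier × B.carrier)} (hE : E ∈ 𝓤 B.carrier) :
    {p : X × X | (B.map p.1, B.map p.2) ∈ E} ∈ 𝓤[B.subspaceUniformity] :=
  mem_subspaceUniformity.2 ⟨E, hE, fun _ _ h => h⟩

theorem toTopologicalSpace_subspaceUniformity (B : Compactification X) :
    B.subspaceUniformity.toTopologicalSpace = ‹TopologicalSpace X› :=
  B.isEmbedding.eq_induced.symm

theorem totallyBounded_subspaceUniformity (B : Compactification X) :
    @TotallyBounded X B.subspaceUniformity univ :=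
  totallyBounded_comap_compact (K := B.carrier) B.map

/-- Maps into a compactification that are uniformly continuous for the subspace uniformity extend
to the compactification. -/
theorem exists_continuous_extension {B C : Compactification X} {f : X → X}
    (hf : C.subspaceUniformity ≤ UniformSpace.comap f B.subspaceUniformity) :
    ∃ φ : C.carrier → B.carrier, Continuous φ ∧ ∀ x, φ (C.map x) = B.map (f x) := by
  let _ : UniformSpace X := C.subspaceUniformity
  have hi : IsUniformInducing C.map := ⟨rfl⟩
  have hu : UniformContinuous fun x => B.map (f x) := by
    rw [uniformContinuous_iff_le_comap]
    refine hf.trans_eq ?_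
    rw [subspaceUniformity_eq, ← UniformSpace.comap_comap]
    rfl
  exact ⟨_, (uniformContinuous_uniformly_extend hi C.denseRange hu).continuous,
    fun x => uniformly_extend_of_ind hi C.denseRange hu x⟩

theorem subspaceUniformity_le_of_extension {B C : Compactification X} {f : X → X}
    {φ : C.carrier → B.carrier} (hφ : Continuous φ) (h : ∀ x, φ (C.map x) = B.map (f x)) :
    C.subspaceUniformity ≤ UniformSpace.comap f B.subspaceUniformity := by
  have hu := CompactSpace.uniformContinuous_of_continuous hφ
  rw [uniformContinuous_iff_le_comap] at hu
  calc C.subspaceUniformity ≤ UniformSpace.comap C.map (UniformSpace.comap φ B.uniformSpace) :=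
        UniformSpace.comap_mono hu
    _ = UniformSpace.comap f B.subspaceUniformity := by
        rw [subspaceUniformity_eq, ← UniformSpace.comap_comap, ← UniformSpace.comap_comap]
        congr 1
        exact funext h

/-- Continuous maps of compact spaces are uniformly continuous; conversely, a uniformly continuous
map on the dense subspace extends. -/
theorem le_iff_subspaceUniformity_le {B C : Compactification X} :
    B ≤ C ↔ C.subspaceUniformity ≤ B.subspaceUniformity := by
  refine ⟨fun ⟨φ, hφ, h⟩ => ?_, fun h => ?_⟩
  · simpa using! subspaceUniformity_le_of_extension (f := id) hφ h
  · exact exists_continuous_extension (f := id) (by simpa using! h)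

end Uniformity

/-! ### Extending actions -/

section Action

variable {G : Type u} [Group G] [TopologicalSpace G]

/-- Each translation extends by uniform continuity. Joint continuity needs only that elements near
`1` move all points uniformly little. -/
theorem nonempty_actionExtension [IsTopologicalGroup G] {B : Compactification G} {a : G → G → G}
    (h1 : ∀ x, a 1 x = x) (hmul : ∀ g h x, a (g * h) x = a g (a h x))
    (hu : ∀ g, B.subspaceUniformity ≤ UniformSpace.comap (a g) B.subspaceUniformity)
    (hnear : ∀ D ∈ 𝓤[B.subspaceUniformity], ∀ᶠ g in 𝓝 (1 : G), ∀ x, (x, a g x) ∈ D) :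
    Nonempty (ActionExtension B a) := by
  choose φ hφ hφa using fun g => exists_continuous_extension (hu g)
  have φmul : ∀ g h x, φ (g * h) x = φ g (φ h x) := fun g h => by
    refine congr_fun (B.denseRange.equalizer (hφ _) ((hφ g).comp (hφ h)) (funext fun x => ?_))
    simp [hφa, hmul]
  refine ⟨⟨φ, ?_, φmul, ?_, hφa⟩⟩
  · refine congr_fun (B.denseRange.equalizer (hφ 1) continuous_id (funext fun x => ?_))
    simp [hφa, h1]
  · have near : ∀ E ∈ 𝓤 B.carrier, ∀ᶠ g in 𝓝 (1 : G), ∀ x, (x, φ g x) ∈ E := by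
      intro E hE
      -- A closed entourage lets the estimate pass from `G` to its closure.
      obtain ⟨E', ⟨hE', hcl⟩, hsub⟩ := uniformity_hasBasis_closed.mem_iff.1 hE
      filter_upwards [hnear _ (preimage_mem_subspaceUniformity hE')] with g hg x
      refine hsub (B.denseRange.induction_on x
        (hcl.preimage (continuous_id.prodMk (hφ g))) fun y => ?_)
      simpa [hφa] using hg y
    rw [continuous_iff_continuousAt]
    rintro ⟨g, x⟩
    rw [ContinuousAt, Uniform.tendsto_nhds_right, Function.uncurry_apply_pair]
    intro E hE
    obtain ⟨E', hE', hsub⟩ := comp_mem_uniformity_sets hE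
    -- Factor `q.1 = (q.1 * g⁻¹) * g`: continuity of `φ g` handles the point, and the remaining
    -- factor is near `1`.
    have ht : Tendsto (fun q : G × B.carrier => q.1 * g⁻¹) (𝓝 (g, x)) (𝓝 1) := by
      have : Continuous fun q : G × B.carrier => q.1 * g⁻¹ := by fun_prop
      simpa using this.tendsto (g, x)
    have ht2 : Tendsto (fun q : G × B.carrier => φ g q.2) (𝓝 (g, x)) (𝓝 (φ g x)) :=
      ((hφ g).comp continuous_snd).tendsto (g, x)
    have ht3 : ∀ᶠ q in 𝓝 (g, x), (φ g x, φ g q.2) ∈ E' := Uniform.tendsto_nhds_right.1 ht2 hE'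
    refine mem_map.2 ?_
    filter_upwards [ht (near E' hE'), ht3] with q hq hq2
    refine hsub ⟨_, hq2, ?_⟩
    have := hq (φ g q.2)
    rwa [← φmul, inv_mul_cancel_right] at this

theorem _root_.ActionExtension.subspaceUniformity_le_comap {B : Compactification G}
    {a : G → G → G} (θ : ActionExtension B a) (g : G) :
    B.subspaceUniformity ≤ UniformSpace.comap (a g) B.subspaceUniformity :=
  subspaceUniformity_le_of_extension
    (θ.continuous_act.comp (Continuous.prodMk_right g)) fun x => θ.act_map g x

/-- Tube lemma along the compact slice `{1} × bG`. -/
theorem _root_.ActionExtension.eventually_mem {B : Compactification G}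
    {a : G → G → G} (θ : ActionExtension B a) {D : Set (G × G)}
    (hD : D ∈ 𝓤[B.subspaceUniformity]) : ∀ᶠ g in 𝓝 (1 : G), ∀ x, (x, a g x) ∈ D := by
  obtain ⟨E, hE, hED⟩ := mem_subspaceUniformity.1 hD
  obtain ⟨E', ⟨hE', hop⟩, hsub⟩ := uniformity_hasBasis_open.mem_iff.1 hE
  have hc : Continuous fun p : G × B.carrier => (p.2, θ.act p.1 p.2) :=
    continuous_snd.prodMk θ.continuous_act
  obtain ⟨V, W, hV, -, h1V, hW, hVW⟩ := generalized_tube_lemma (isCompact_singleton (x := (1 : G)))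
    (isCompact_univ (X := B.carrier)) (hop.preimage hc) (by
      rintro ⟨g, x⟩ ⟨hg, -⟩
      obtain rfl : g = 1 := hg
      simpa [θ.act_one] using refl_mem_uniformity hE')
  filter_upwards [hV.mem_nhds (h1V rfl)] with g hg x
  refine hED _ _ (hsub ?_)
  simpa [θ.act_map] using hVW (mk_mem_prod hg (hW (mem_univ (B.map x))))

end Action

end Compactification

/-! ### The uniformity of the graph compactification -/

section GraphUniformity

variable {G : Type u} [Group G]

/-- The pairs `(g, h)` for which the graphs of the left translations by `g` and `h` are contained in
each other's `E × E`-thickening. -/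
def graphEntourage (E : Set (G × G)) : Set (G × G) :=
  {p | (∀ x, ∃ y, (x, y) ∈ E ∧ (p.1 * x, p.2 * y) ∈ E) ∧
    ∀ y, ∃ x, (x, y) ∈ E ∧ (p.1 * x, p.2 * y) ∈ E}

/-- The graph of `g⁻¹` is the graph of `g` with coordinates swapped, and `E × E` is invariant under
the swap. -/
theorem graphEntourage_inv {E : Set (G × G)} {g h : G} (H : (g, h) ∈ graphEntourage E) :
    (g⁻¹, h⁻¹) ∈ graphEntourage E := by
  refine ⟨fun x => ?_, fun y => ?_⟩
  · obtain ⟨y, hy, hy'⟩ := H.1 (g⁻¹ * x)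
    exact ⟨h * y, by simpa using hy', by simpa using hy⟩
  · obtain ⟨x, hx, hx'⟩ := H.2 (h⁻¹ * y)
    exact ⟨g * x, by simpa using hx', by simpa using hx⟩

variable [TopologicalSpace G]

-- The Hausdorff uniformity compares graphs over `bG`, `graphEntourage` compares graphs over `G`; as
-- the latter are dense in the former, the two differ by one halving of entourages.
open Compactification SetRel in
theorem uniformity_graphCompactification {B : Compactification G}
    (θ : ActionExtension B leftMul) :
    𝓤[(graphCompactification θ).subspaceUniformity] =
      𝓤[B.subspaceUniformity].lift' graphEntourage := by
  have hθ : ∀ g, Continuous (θ.act g) := fun g =>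
    θ.continuous_act.comp (Continuous.prodMk_right g)
  -- Density of the graph over `G`: a point of `G` near `x` has image near `g x`.
  have approx : ∀ E ∈ 𝓤 B.carrier, ∀ (g : G) (x : B.carrier), ∃ x' : G,
      (x, B.map x') ∈ E ∧ (θ.act g x, B.map (g * x')) ∈ E := by
    intro E hE g x
    have h1 : ∀ᶠ z in 𝓝 x, (x, z) ∈ E := mem_nhds_left x hE
    have h2 : ∀ᶠ z in 𝓝 x, (θ.act g x, θ.act g z) ∈ E :=
      (hθ g).continuousAt.eventually (mem_nhds_left (θ.act g x) hE)
    obtain ⟨_, ⟨x', rfl⟩, h⟩ := (mem_closure_iff_nhds.1 (B.denseRange x) _ (h1.and h2)).imp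
      fun _ h => And.symm h
    exact ⟨x', h.1, by simpa [θ.act_map, leftMul] using h.2⟩
  have hb : (𝓤[(graphCompactification θ).subspaceUniformity]).HasBasis (· ∈ 𝓤 B.carrier)
      fun E => {p : G × G | ((θ.graph p.1 : Set (B.carrier × B.carrier)), (θ.graph p.2 : Set _)) ∈
        hausdorffEntourage (entourageProd E E)} := by
    rw [subspaceUniformity_eq_comap (graphCompactification θ)
      (inferInstanceAs (UniformSpace (closure (range θ.graph)))) rfl]
    have h : (𝓤 (B.carrier × B.carrier)).HasBasis (· ∈ 𝓤 B.carrier)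
        fun E => entourageProd E E := by
      refine ((𝓤 B.carrier).basis_sets.uniformity_prod (𝓤 B.carrier).basis_sets).to_hasBasis
        (fun E hE => ⟨E.1 ∩ E.2, inter_mem hE.1 hE.2, fun p hp => ⟨hp.1.1, hp.2.2⟩⟩)
        fun E hE => ⟨(E, E), ⟨hE, hE⟩, subset_rfl⟩
    exact ((h.uniformity_hausdorff.comap _).comap _).comap _
  refine le_antisymm (le_lift'.2 fun D hD => ?_) (hb.ge_iff.2 fun E hE => ?_)
  · obtain ⟨E, hE, hED⟩ := mem_subspaceUniformity.1 hD
    obtain ⟨E', hE', hs, hsub⟩ := comp_symm_mem_uniformity_sets hE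
    refine mem_of_superset (hb.mem_of_mem hE') ?_
    rintro ⟨g, h⟩ ⟨h1, h2⟩
    refine ⟨fun x => ?_, fun y => ?_⟩
    · obtain ⟨_, ⟨y, rfl⟩, hy⟩ := h1 ⟨B.map x, rfl⟩
      obtain ⟨y', hy1, hy2⟩ := approx E' hE' h y
      refine ⟨y', hED _ _ (hsub ⟨_, hy.1, hy1⟩), hED _ _ (hsub ⟨_, ?_, hy2⟩)⟩
      simpa [θ.act_map, leftMul] using hy.2
    · obtain ⟨_, ⟨x, rfl⟩, hx⟩ := h2 ⟨B.map y, rfl⟩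
      obtain ⟨x', hx1, hx2⟩ := approx E' hE' g x
      refine ⟨x', hED _ _ (hsub ⟨_, hs.symm _ _ hx1, hx.1⟩),
        hED _ _ (hsub ⟨_, hs.symm _ _ hx2, ?_⟩)⟩
      simpa [θ.act_map, leftMul] using hx.2
  · obtain ⟨E', hE', hs, hsub⟩ := comp_symm_mem_uniformity_sets hE
    refine mem_of_superset (mem_lift' (preimage_mem_subspaceUniformity hE')) ?_
    rintro ⟨g, h⟩ ⟨h1, h2⟩
    have hmap : ∀ (k : G) (x : G), (B.map x, B.map (k * x)) ∈ (θ.graph k : Set _) :=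
      fun k x => ⟨B.map x, by simp [θ.act_map, leftMul]⟩
    refine ⟨?_, ?_⟩
    · rintro _ ⟨x, rfl⟩
      obtain ⟨x', hx1, hx2⟩ := approx E' hE' g x
      obtain ⟨y, hy1, hy2⟩ := h1 x'
      exact ⟨_, hmap h y, hsub ⟨_, hx1, hy1⟩, hsub ⟨_, hx2, hy2⟩⟩
    · rintro _ ⟨y, rfl⟩
      obtain ⟨y', hy1, hy2⟩ := approx E' hE' h y
      obtain ⟨x, hx1, hx2⟩ := h2 y'
      exact ⟨_, hmap g x, hsub ⟨_, hx1, hs.symm _ _ hy1⟩, hsub ⟨_, hx2, hs.symm _ _ hy2⟩⟩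

end GraphUniformity

/-! ### Properties of the graph compactification -/

section GraphCompactification

open Compactification

variable {G : Type u} [Group G] [TopologicalSpace G]

theorem le_subspaceUniformity_graphCompactification {B : Compactification G}
    {θ : ActionExtension B leftMul} {𝒰 : UniformSpace G} :
    𝒰 ≤ (graphCompactification θ).subspaceUniformity ↔
      ∀ D ∈ 𝓤[B.subspaceUniformity], graphEntourage D ∈ 𝓤[𝒰] := by
  rw [← le_lift', ← uniformity_graphCompactification θ]
  rfl

theorem subspaceUniformity_graphCompactification_le_comap {B : Compactification G}
    {θ : ActionExtension B leftMul} {f : G → G}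
    (H : ∀ D ∈ 𝓤[B.subspaceUniformity], ∃ E ∈ 𝓤[B.subspaceUniformity],
      ∀ g h, (g, h) ∈ graphEntourage E → (f g, f h) ∈ graphEntourage D) :
    (graphCompactification θ).subspaceUniformity ≤
      UniformSpace.comap f (graphCompactification θ).subspaceUniformity := by
  change 𝓤[(graphCompactification θ).subspaceUniformity] ≤
    comap _ 𝓤[(graphCompactification θ).subspaceUniformity]
  rw [← tendsto_iff_comap, uniformity_graphCompactification]
  refine tendsto_lift'.2 fun D hD => ?_
  obtain ⟨E, hE, hED⟩ := H D hD
  exact mem_of_superset (mem_lift' hE) fun p hp => hED _ _ hp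

theorem graphCompactification_mono {B C : Compactification G} (θ : ActionExtension B leftMul)
    (η : ActionExtension C leftMul) (h : B ≤ C) :
    graphCompactification θ ≤ graphCompactification η := by
  rw [le_iff_subspaceUniformity_le] at h ⊢
  refine le_subspaceUniformity_graphCompactification.2 fun D hD => ?_
  exact le_subspaceUniformity_graphCompactification.1 le_rfl D (h hD)

/-- If the graphs of `g` and `h` are close, the point `(1, g)` is near some `(y, h y)`. Since `y` is
near `1` and `α*` extends, `h y` is near `h` uniformly in `h`; hence `g` is near `h`. -/
theorem le_graphCompactification {B : Compactification G} (θ : ActionExtension B leftMul)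
    (hB : B.IsGBi) : B ≤ graphCompactification θ := by
  obtain ⟨-, ⟨η⟩⟩ := hB
  rw [le_iff_subspaceUniformity_le]
  change 𝓤[(graphCompactification θ).subspaceUniformity] ≤ 𝓤[B.subspaceUniformity]
  rw [uniformity_graphCompactification]
  intro D hD
  obtain ⟨D', hD', hsub⟩ := @comp_mem_uniformity_sets _ B.subspaceUniformity _ hD
  have hn : {x : G | ∀ y, (y * x, y) ∈ D'} ∈ 𝓝 (1 : G) := by
    filter_upwards [η.eventually_mem hD'] with x hx y
    simpa [leftMulStar] using hx (y * x)
  -- The embedding turns this neighbourhood of `1` into one containing a ball for the uniformity of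
  -- `bG`.
  rw [← B.toTopologicalSpace_subspaceUniformity,
    @UniformSpace.mem_nhds_iff _ B.subspaceUniformity] at hn
  obtain ⟨E, hE, hEsub⟩ := hn
  refine mem_of_superset (mem_lift' (inter_mem hE hD')) ?_
  rintro ⟨g, h⟩ ⟨h1, -⟩
  obtain ⟨y, hy1, hy2⟩ := h1 1
  refine hsub ⟨h * y, ?_, hEsub hy1.1 h⟩
  simpa using hy2.2

theorem graphCompactification_le_iff {B : Compactification G} (θ : ActionExtension B leftMul) :
    graphCompactification θ ≤ B ↔
      ∀ D ∈ 𝓤[B.subspaceUniformity], graphEntourage D ∈ 𝓤[B.subspaceUniformity] := by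
  rw [le_iff_subspaceUniformity_le, le_subspaceUniformity_graphCompactification]

variable [IsTopologicalGroup G]

/-- For the right uniformity, `g x` and `h x` are close at the same `x`. For the left one, `(x, g
x)` is matched with the point of the graph of `h` over `h⁻¹ g x`, which has the same second
coordinate. -/
theorem roelckeUniformity_le_graphCompactification {B : Compactification G}
    (θ : ActionExtension B leftMul) :
    roelckeUniformity G ≤ (graphCompactification θ).subspaceUniformity := by
  have hrefl : ∀ D ∈ 𝓤[B.subspaceUniformity], ∀ x, (x, x) ∈ D := fun D hD x =>
    @refl_mem_uniformity _ B.subspaceUniformity _ _ hD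
  refine sup_le ?_ ?_
  · refine le_subspaceUniformity_graphCompactification.2 fun D hD => ?_
    have hn := θ.eventually_mem hD
    -- The left uniformity controls `g⁻¹ h`, while the matching point uses its inverse.
    have hn' := (continuous_inv (G := G)).tendsto' 1 1 inv_one |>.eventually hn
    refine ⟨_, hn', ?_⟩
    rintro ⟨g, h⟩ hgh
    have key : ∀ x, (x, h⁻¹ * g * x) ∈ D := by simpa [leftMul] using hgh
    refine ⟨fun x => ⟨_, key x, ?_⟩, fun y => ⟨g⁻¹ * h * y, ?_, ?_⟩⟩
    · simpa [leftMul, mul_assoc] using hrefl D hD _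
    · simpa [mul_assoc] using key (g⁻¹ * h * y)
    · simpa [mul_assoc] using hrefl D hD _
  · refine le_subspaceUniformity_graphCompactification.2 fun D hD => ?_
    refine ⟨_, θ.eventually_mem hD, ?_⟩
    rintro ⟨g, h⟩ hgh
    have key : ∀ x, (g * x, h * x) ∈ D := fun x => by simpa [leftMul, mul_assoc] using hgh (g * x)
    exact ⟨fun x => ⟨x, hrefl D hD _, key x⟩,
      fun x => ⟨x, hrefl D hD _, key x⟩⟩

theorem eventually_mul_left_mem {𝒰 : UniformSpace G} (h : roelckeUniformity G ≤ 𝒰)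
    {D : Set (G × G)} (hD : D ∈ 𝓤[𝒰]) : ∀ᶠ g in 𝓝 (1 : G), ∀ x, (x, g * x) ∈ D := by
  have hR : IsTopologicalGroup.rightUniformSpace G ≤ 𝒰 := le_sup_right.trans h
  obtain ⟨O, hO, hOD⟩ := hR hD
  filter_upwards [hO] with g hg x
  exact hOD (by simpa using hg)

theorem eventually_mul_right_inv_mem {𝒰 : UniformSpace G} (h : roelckeUniformity G ≤ 𝒰)
    {D : Set (G × G)} (hD : D ∈ 𝓤[𝒰]) : ∀ᶠ g in 𝓝 (1 : G), ∀ x, (x, x * g⁻¹) ∈ D := by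
  have hL : IsTopologicalGroup.leftUniformSpace G ≤ 𝒰 := le_sup_left.trans h
  obtain ⟨O, hO, hOD⟩ := hL hD
  filter_upwards [inv_mem_nhds_one G hO] with g hg x
  exact hOD (by simpa using hg)

theorem isGStar_graphCompactification {B : Compactification G} (θ : ActionExtension B leftMul) :
    (graphCompactification θ).IsGStar := by
  refine ⟨nonempty_actionExtension one_mul mul_assoc (fun g => ?_)
    (fun D hD => eventually_mul_left_mem (roelckeUniformity_le_graphCompactification θ) hD), ?_⟩
  -- The graph of `g k` is the image of that of `k` under `id × g`; the two sets intersected control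
  -- the two coordinates.
  · refine subspaceUniformity_graphCompactification_le_comap fun D hD =>
      ⟨_, inter_mem hD (θ.subspaceUniformity_le_comap g (preimage_mem_comap hD)), ?_⟩
    rintro k l ⟨h1, h2⟩
    refine ⟨fun x => (h1 x).imp fun y hy => ⟨hy.1.1, ?_⟩,
      fun y => (h2 y).imp fun x hx => ⟨hx.1.1, ?_⟩⟩
    · simpa [leftMul, mul_assoc] using hy.2.2
    · simpa [leftMul, mul_assoc] using hx.2.2
  · obtain ⟨s, hs, hsm⟩ := exists_continuous_extension
      (subspaceUniformity_graphCompactification_le_comap (θ := θ) (f := fun g => g⁻¹)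
        fun D hD => ⟨D, hD, fun _ _ => graphEntourage_inv⟩)
    refine ⟨s, hs, congr_fun ((graphCompactification θ).denseRange.equalizer (hs.comp hs)
      continuous_id (funext fun x => ?_)), hsm⟩
    simp [hsm]

end GraphCompactification

/-! ### Entourages and stars of covers -/

section Cover

variable {X : Type*} {𝒰 : UniformSpace X}

theorem mem_coverStar_comm {x y : X} {u : Set (Set X)} :
    x ∈ coverStar y u ↔ y ∈ coverStar x u :=
  ⟨fun ⟨U, ⟨hU, hy⟩, hx⟩ => ⟨U, ⟨hU, hx⟩, hy⟩, fun ⟨U, ⟨hU, hx⟩, hy⟩ => ⟨U, ⟨hU, hy⟩, hx⟩⟩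

theorem IsUniformCover.exists_subset_coverStar {u : Set (Set X)} (hu : IsUniformCover 𝒰 u) :
    ∃ D ∈ 𝓤[𝒰], ∀ x y, (x, y) ∈ D → x ∈ coverStar y u := by
  obtain ⟨D, hD, h⟩ := hu
  refine ⟨D, hD, fun x y hxy => ?_⟩
  obtain ⟨U, hU, hsub⟩ := h x
  exact ⟨U, ⟨hU, hsub hxy⟩, hsub (refl_mem_uniformity hD)⟩

/-- Take the balls of a symmetric half of `D`: two points of one ball are `D`-close through its
centre. -/
theorem exists_isUniformCover_coverStar {D : Set (X × X)} (hD : D ∈ 𝓤[𝒰]) :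
    ∃ u, IsUniformCover 𝒰 u ∧ ∀ x y, x ∈ coverStar y u → (x, y) ∈ D := by
  obtain ⟨E, hE, hs, hsub⟩ := comp_symm_mem_uniformity_sets hD
  refine ⟨range fun z => {y | (z, y) ∈ E}, ⟨E, hE, fun x => ⟨_, mem_range_self x, subset_rfl⟩⟩, ?_⟩
  rintro x y ⟨_, ⟨⟨z, rfl⟩, hy⟩, hx⟩
  exact hsub ⟨z, hs.symm _ _ hx, hy⟩

end Cover

theorem Compactification.conditionF_iff {G : Type u} [Group G] [TopologicalSpace G]
    {B : Compactification G} : B.ConditionF ↔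
      ∀ D ∈ 𝓤[B.subspaceUniformity], graphEntourage D ∈ 𝓤[B.subspaceUniformity] := by
  constructor
  · intro H D hD
    obtain ⟨u, hu, huD⟩ := exists_isUniformCover_coverStar hD
    obtain ⟨v, hv, hvu⟩ := H u hu
    obtain ⟨E, hE, hEv⟩ := hv.exists_subset_coverStar
    refine mem_of_superset hE ?_
    rintro ⟨g, h⟩ hgh
    obtain ⟨h1, h2⟩ := hvu g h (hEv _ _ hgh)
    -- The two halves of `ConditionF` come in the opposite order to those of `graphEntourage`.
    exact ⟨fun x => (h2 x).imp fun y hy => ⟨huD _ _ hy.1, huD _ _ hy.2⟩, fun y => (h1 y).imp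
      fun x hx => ⟨huD _ _ (mem_coverStar_comm.1 hx.1), huD _ _ (mem_coverStar_comm.1 hx.2)⟩⟩
  · intro H u hu
    obtain ⟨D, hD, hDu⟩ := hu.exists_subset_coverStar
    obtain ⟨v, hv, hvD⟩ := exists_isUniformCover_coverStar (H D hD)
    refine ⟨v, hv, fun g h hgh => ?_⟩
    obtain ⟨h1, h2⟩ := hvD g h hgh
    exact ⟨fun y => (h2 y).imp fun x hx =>
        ⟨mem_coverStar_comm.1 (hDu _ _ hx.1), mem_coverStar_comm.1 (hDu _ _ hx.2)⟩,
      fun x => (h1 x).imp fun y hy => ⟨hDu _ _ hy.1, hDu _ _ hy.2⟩⟩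

/-! ### Comparison with the Roelcke compactification -/

section Roelcke

open Compactification

theorem le_precompactReplica {X : Type u} (𝒰 : UniformSpace X) : 𝒰 ≤ precompactReplica 𝒰 :=
  le_sInf fun _ h => h.1

/-- The pullback of the replica is totally bounded and coarser than `𝒰`, so the replica, being the
finest such, refines it. -/
theorem precompactReplica_le_comap {X : Type u} {𝒰 : UniformSpace X} {f : X → X}
    (hf : 𝒰 ≤ UniformSpace.comap f 𝒰) :
    precompactReplica 𝒰 ≤ UniformSpace.comap f (precompactReplica 𝒰) := by
  refine sInf_le ⟨hf.trans (UniformSpace.comap_mono (le_precompactReplica 𝒰)), ?_⟩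
  have h := @totallyBounded_preimage X X (UniformSpace.comap f (precompactReplica 𝒰))
    (precompactReplica 𝒰) f univ (@IsUniformInducing.mk X X (_) (_) f rfl)
    (totallyBounded_precompactReplica 𝒰)
  rwa [preimage_univ] at h

variable {G : Type u} [Group G] [TopologicalSpace G] [IsTopologicalGroup G]

/-- Left translation fixes `x⁻¹ y` and conjugates `y x⁻¹` by `g`; conjugation is continuous at `1`.
-/
theorem roelckeUniformity_le_comap_mul_left (g : G) :
    roelckeUniformity G ≤ UniformSpace.comap (fun x => g * x) (roelckeUniformity G) := by
  refine sup_le (le_trans ?_ (UniformSpace.comap_mono le_sup_left))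
    (le_trans ?_ (UniformSpace.comap_mono le_sup_right))
  · change comap (fun p : G × G => p.1⁻¹ * p.2) (𝓝 1) ≤
      comap _ (comap (fun p : G × G => p.1⁻¹ * p.2) (𝓝 1))
    rw [comap_comap]
    refine le_of_eq (congrArg (fun f => comap f (𝓝 1)) (funext fun p => ?_))
    simp [mul_assoc]
  · change comap (fun p : G × G => p.2 * p.1⁻¹) (𝓝 1) ≤
      comap _ (comap (fun p : G × G => p.2 * p.1⁻¹) (𝓝 1))
    rw [comap_comap, ← tendsto_iff_comap]
    have h : Tendsto (fun x => g * x * g⁻¹) (𝓝 1) (𝓝 (1 : G)) :=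
      Continuous.tendsto' (by fun_prop) _ _ (by simp)
    refine (h.comp tendsto_comap).congr fun p => ?_
    simp [mul_assoc]

theorem roelckeUniformity_le_comap_mul_right (g : G) :
    roelckeUniformity G ≤ UniformSpace.comap (fun x => x * g) (roelckeUniformity G) := by
  refine sup_le (le_trans ?_ (UniformSpace.comap_mono le_sup_left))
    (le_trans ?_ (UniformSpace.comap_mono le_sup_right))
  · change comap (fun p : G × G => p.1⁻¹ * p.2) (𝓝 1) ≤
      comap _ (comap (fun p : G × G => p.1⁻¹ * p.2) (𝓝 1))
    rw [comap_comap, ← tendsto_iff_comap]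
    have h : Tendsto (fun x => g⁻¹ * x * g) (𝓝 1) (𝓝 (1 : G)) :=
      Continuous.tendsto' (by fun_prop) _ _ (by simp)
    refine (h.comp tendsto_comap).congr fun p => ?_
    simp [mul_assoc]
  · change comap (fun p : G × G => p.2 * p.1⁻¹) (𝓝 1) ≤
      comap _ (comap (fun p : G × G => p.2 * p.1⁻¹) (𝓝 1))
    rw [comap_comap]
    refine le_of_eq (congrArg (fun f => comap f (𝓝 1)) (funext fun p => ?_))
    simp [mul_assoc]

variable [T2Space G]

variable (G) in
theorem subspaceUniformity_roelckeCompactification :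
    (roelckeCompactification G).subspaceUniformity = precompactReplica (roelckeUniformity G) := by
  rw [subspaceUniformity_eq_comap (roelckeCompactification G)
    (@UniformSpace.Completion.uniformSpace G (precompactReplica (roelckeUniformity G))) rfl]
  exact @IsUniformInducing.comap_uniformSpace _ _ (precompactReplica (roelckeUniformity G)) (_) _
    (@UniformSpace.Completion.isUniformInducing_coe G (precompactReplica (roelckeUniformity G)))

variable (G) in
theorem isGBi_roelckeCompactification : (roelckeCompactification G).IsGBi := by
  have h := subspaceUniformity_roelckeCompactification G
  have hle : roelckeUniformity G ≤ (roelckeCompactification G).subspaceUniformity :=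
    h ▸ le_precompactReplica _
  refine ⟨nonempty_actionExtension one_mul mul_assoc (fun g => ?_)
      fun D hD => eventually_mul_left_mem hle hD,
    nonempty_actionExtension (fun x => by simp [leftMulStar])
      (fun g h x => by simp [leftMulStar, mul_assoc]) (fun g => ?_)
      fun D hD => eventually_mul_right_inv_mem hle hD⟩
  · rw [h]
    exact precompactReplica_le_comap (roelckeUniformity_le_comap_mul_left g)
  · rw [h]
    exact precompactReplica_le_comap (roelckeUniformity_le_comap_mul_right g⁻¹)

theorem graphCompactification_le_roelckeCompactification {B : Compactification G}
    (θ : ActionExtension B leftMul) : graphCompactification θ ≤ roelckeCompactification G := by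
  rw [le_iff_subspaceUniformity_le, subspaceUniformity_roelckeCompactification]
  exact sInf_le ⟨roelckeUniformity_le_graphCompactification θ,
    totallyBounded_subspaceUniformity _⟩

theorem roelckeCompactification_le_graphCompactification {B : Compactification G}
    (θ : ActionExtension B leftMul) (h : roelckeCompactification G ≤ B) :
    roelckeCompactification G ≤ graphCompactification θ := by
  have hG := isGBi_roelckeCompactification G
  obtain ⟨η⟩ := hG.1
  exact (le_graphCompactification η hG).trans (graphCompactification_mono η θ h)

end Roelcke

/-! ### The map of posets -/

section GraphMap

variable {G : Type u} [Group G] [TopologicalSpace G]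

theorem exists_cls_eq (p : GPoset G) :
    ∃ (B : Compactification G) (θ : ActionExtension B leftMul), θ.cls = p := by
  obtain ⟨_, B, ⟨θ⟩, rfl⟩ := p
  exact ⟨B, θ, rfl⟩

/-- The map of posets which sends the class of a `G`-compactification to the class of its
compactification by graphs. -/
noncomputable def graphMap (G : Type u) [Group G] [TopologicalSpace G] [IsTopologicalGroup G] :
    GPoset G →o GStarPoset G where
  toFun p := ⟨(graphCompactification (exists_cls_eq p).choose_spec.choose).cls, _,
    isGStar_graphCompactification _, rfl⟩
  monotone' p q h := by
    have hp := (exists_cls_eq p).choose_spec.choose_spec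
    have hq := (exists_cls_eq q).choose_spec.choose_spec
    rw [← hp, ← hq] at h
    exact graphCompactification_mono _ _ h

/-- Monotonicity in both directions makes the chosen representative irrelevant. -/
theorem graphMap_cls [IsTopologicalGroup G] {B : Compactification G}
    (θ : ActionExtension B leftMul) :
    (graphMap G θ.cls : CompactificationPoset G) = (graphCompactification θ).cls := by
  have h := (exists_cls_eq θ.cls).choose_spec.choose_spec
  exact le_antisymm (graphCompactification_mono _ _ (Subtype.ext_iff.1 h).le)
    (graphCompactification_mono _ _ (Subtype.ext_iff.1 h).ge)

end GraphMap

theorem mainTheorem1 {G : Type u} [Group G] [TopologicalSpace G] [IsTopologicalGroup G]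
    [T2Space G] :
    ∃ 𝔊 : GPoset G →o GStarPoset G,
      (∀ (B : Compactification G) (θ : ActionExtension B leftMul),
        (𝔊 θ.cls : CompactificationPoset G) = (graphCompactification θ).cls) ∧
      (∀ p : GPoset G, (p : CompactificationPoset G) ∈ GBiPoset G →
        (p : CompactificationPoset G) ≤ 𝔊 p) ∧
      (∀ p : GPoset G,
        (𝔊 p : CompactificationPoset G) ≤ (roelckeCompactification G).cls ∧
        ((roelckeCompactification G).cls ≤ (p : CompactificationPoset G) →
          (𝔊 p : CompactificationPoset G) = (roelckeCompactification G).cls)) ∧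
      (∀ (B : Compactification G) (θ : ActionExtension B leftMul), B.IsGBi →
        ((𝔊 θ.cls : CompactificationPoset G) = B.cls ↔ B.ConditionF)) := by
  refine ⟨graphMap G, fun B θ => graphMap_cls θ, ?_, fun p => ?_, fun B θ hB => ?_⟩
  · rintro ⟨_, hp⟩ ⟨B, hB, rfl⟩
    obtain ⟨θ⟩ := hB.1
    have h := graphMap_cls θ
    exact (le_graphCompactification θ hB : B.cls ≤ _).trans_eq h.symm
  · obtain ⟨B, θ, rfl⟩ := exists_cls_eq p
    rw [graphMap_cls]
    have h := graphCompactification_le_roelckeCompactification θ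
    exact ⟨h, fun hle => le_antisymm (a := (graphCompactification θ).cls) h
      (roelckeCompactification_le_graphCompactification θ hle)⟩
  · rw [graphMap_cls, Compactification.conditionF_iff, ← graphCompactification_le_iff θ]
    -- Only `𝔊(bG) ≤ bG` is at stake, since the reverse inequality holds by 2.
    exact ⟨fun h => h.le, fun h => le_antisymm (a := (graphCompactification θ).cls) h
      (le_graphCompactification θ hB)⟩
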